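/- Let $R$ be an associative unital ring, not necessarily commutative, and let $n>1$ be an integer. A module $X$ is finitely $n$-presented if there is an exact sequence $F_n\to F_{n-1}\to\cdots\to F_0\to X\to 0$ with every $F_i$ finitely generated projective. A left $R$-module $M$ is $FP_n$-flat if $\operatorname{Tor}^R_1(X,M)=0$ for every finitely $n$-presented right $R$-module $X$. The ring $R$ is right $n$-hereditary if every finitely $(n-1)$-presented submodule of a finitely generated projective right $R$-module is projective. An $FP_n$-flat envelope of a left $R$-module $M$ is a homomorphism $\varphi\colon M\to E$ with $E$ $FP_n$-flat such that every homomorphism from $M$ to an $FP_n$-flat left module factors through $\varphi$, and every endomorphism $g$ of $E$ with $g\varphi=\varphi$ is an automorphism; it is epimorphic if $\varphi$ is surjective. Then the following are equivalent: 1. every left $R$-module has an epimorphic $FP_n$-flat envelope; 2. $R$ is right $n$-hereditary; 3. every submodule of an $FP_n$-flat left $R$-module is $FP_n$-flat; 4. the class of $FP_n$-flat left $R$-modules is a pretorsion-free class, that is, it is closed under submodules and direct products. -/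

import Mathlib

open CategoryTheory Limits
open scoped TensorProduct MulOpposite

universe u

/-!
Rings are associative and unital, not necessarily commutative. Left `R`-modules are objects of
`ModuleCat R`, right `R`-modules are modules over the opposite ring `Rᵐᵒᵖ`; the right action
`x · r` is written `MulOpposite.op r • x`.
-/

section FinitelyPresented

variable (S : Type u) [Ring S]

/-- A (left) `S`-module `M` is finitely `n`-presented if there is an exact sequence
`F n → F (n-1) → ⋯ → F 1 → F 0 → M → 0` in which every `F i`, `i ≤ n`, is a finitely generated
projective module. (The values of `F` and `d` beyond the displayed sequence are irrelevant.) -/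
def IsFinitelyNPresented (n : ℕ) (M : Type u) [AddCommGroup M] [Module S M] : Prop :=
  ∃ (F : ℕ → ModuleCat.{u} S) (d : ∀ i, F (i + 1) →ₗ[S] F i) (ε : F 0 →ₗ[S] M),
    (∀ i, i ≤ n → Module.Finite S (F i) ∧ Module.Projective S (F i)) ∧
    Function.Surjective ε ∧
    (1 ≤ n → Function.Exact (d 0) ε) ∧
    ∀ i, i + 2 ≤ n → Function.Exact (d (i + 1)) (d i)

/-- A ring is left `n`-hereditary (`n ≥ 1`) if every finitely `(n-1)`-presented submodule of a
finitely generated projective left module is projective. -/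
def IsLeftNHereditary (n : ℕ) : Prop :=
  ∀ (P : Type u) [AddCommGroup P] [Module S P], Module.Finite S P → Module.Projective S P →
    ∀ K : Submodule S P, IsFinitelyNPresented S (n - 1) K → Module.Projective S K

/-- A ring is right `n`-hereditary if its opposite ring is left `n`-hereditary, that is, if every
finitely `(n-1)`-presented submodule of a finitely generated projective right module is
projective. -/
def IsRightNHereditary (n : ℕ) : Prop :=
  IsLeftNHereditary Sᵐᵒᵖ n

end FinitelyPresented

section Tensor

variable (R : Type u) [Ring R]

/-- The subgroup of `X ⊗[ℤ] M` generated by the elements `(x · r) ⊗ m - x ⊗ (r • m)`. -/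
def balancedRelations (X : Type u) [AddCommGroup X] [Module Rᵐᵒᵖ X]
    (M : Type u) [AddCommGroup M] [Module R M] : AddSubgroup (X ⊗[ℤ] M) :=
  AddSubgroup.closure
    {t | ∃ (x : X) (r : R) (m : M), t = (MulOpposite.op r • x) ⊗ₜ[ℤ] m - x ⊗ₜ[ℤ] (r • m)}

/-- The tensor product `X ⊗_R M` of a right `R`-module `X` and a left `R`-module `M` over a
not necessarily commutative ring, an abelian group. -/
abbrev BalancedTensor (X : Type u) [AddCommGroup X] [Module Rᵐᵒᵖ X]
    (M : Type u) [AddCommGroup M] [Module R M] : Type u :=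
  (X ⊗[ℤ] M) ⧸ balancedRelations R X M

variable {R}

/-- The map `f ⊗_R M : X ⊗_R M → Y ⊗_R M`, `x ⊗ m ↦ f x ⊗ m`, induced by a map `f : X → Y` of
right modules. -/
def BalancedTensor.map {X Y : Type u} [AddCommGroup X] [Module Rᵐᵒᵖ X] [AddCommGroup Y]
    [Module Rᵐᵒᵖ Y] (M : Type u) [AddCommGroup M] [Module R M] (f : X →ₗ[Rᵐᵒᵖ] Y) :
    BalancedTensor R X M →+ BalancedTensor R Y M :=
  QuotientAddGroup.map _ _
    (LinearMap.rTensor M f.toAddMonoidHom.toIntLinearMap).toAddMonoidHom (by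
    refine (AddSubgroup.closure_le _).2 ?_
    rintro _ ⟨x, r, m, rfl⟩
    refine AddSubgroup.subset_closure ⟨f x, r, m, ?_⟩
    rw [map_sub, ← f.map_smul]
    rfl)

/-- Additive maps out of `X ⊗_R M` that agree on the elements `x ⊗ m` are equal. -/
theorem BalancedTensor.hom_ext {X M A : Type u} [AddCommGroup X] [Module Rᵐᵒᵖ X]
    [AddCommGroup M] [Module R M] [AddCommGroup A] {f g : BalancedTensor R X M →+ A}
    (h : ∀ (x : X) (m : M), f (QuotientAddGroup.mk (x ⊗ₜ[ℤ] m)) =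
      g (QuotientAddGroup.mk (x ⊗ₜ[ℤ] m))) : f = g := by
  ext t
  induction t using TensorProduct.induction_on with
  | zero => rw [map_zero, map_zero]
  | tmul x m => exact h x m
  | add a b ha hb => rw [map_add, map_add, ha, hb]

/-- The functor `- ⊗_R M` from right `R`-modules to abelian groups. -/
def tensorFunctor (M : ModuleCat.{u} R) : ModuleCat.{u} Rᵐᵒᵖ ⥤ AddCommGrpCat.{u} where
  obj X := AddCommGrpCat.of (BalancedTensor R X M)
  map f := AddCommGrpCat.ofHom (BalancedTensor.map M f.hom)
  map_id _ := AddCommGrpCat.hom_ext (BalancedTensor.hom_ext fun _ _ => rfl)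
  map_comp _ _ := AddCommGrpCat.hom_ext (BalancedTensor.hom_ext fun _ _ => rfl)

instance tensorFunctor_additive (M : ModuleCat.{u} R) : (tensorFunctor M).Additive where
  map_add {_ Y f g} := AddCommGrpCat.hom_ext (BalancedTensor.hom_ext fun x m =>
    congrArg (QuotientAddGroup.mk (s := balancedRelations R Y M))
      (TensorProduct.add_tmul (f.hom x) (g.hom x) m))

/-- `Tor_i^R(X, M)` as a functor of the right `R`-module `X`: the `i`-th left derived functor of
`- ⊗_R M`. -/
noncomputable def torFunctor (i : ℕ) (M : ModuleCat.{u} R) :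
    ModuleCat.{u} Rᵐᵒᵖ ⥤ AddCommGrpCat.{u} :=
  (tensorFunctor M).leftDerived i

/-- A left `R`-module `M` is `FP_n`-flat if `Tor_1^R(X, M) = 0` for every finitely `n`-presented
right `R`-module `X`. -/
def IsFPFlat (n : ℕ) (M : ModuleCat.{u} R) : Prop :=
  ∀ X : ModuleCat.{u} Rᵐᵒᵖ, IsFinitelyNPresented Rᵐᵒᵖ n X → IsZero ((torFunctor 1 M).obj X)

end Tensor

section Classes

variable {R : Type u} [Ring R]

/-- A map `φ : M → E` is a `C`-preenvelope of `M` if `E` lies in the class `C` and every map from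
`M` to a module in `C` factors through `φ`. -/
def IsPreenvelope (C : ModuleCat.{u} R → Prop) {M E : ModuleCat.{u} R} (φ : M →ₗ[R] E) : Prop :=
  C E ∧ ∀ E' : ModuleCat.{u} R, C E' → ∀ f : M →ₗ[R] E', ∃ g : E →ₗ[R] E', g ∘ₗ φ = f

/-- A `C`-envelope is a `C`-preenvelope `φ : M → E` such that every endomorphism `g` of `E` with
`g ∘ φ = φ` is an automorphism. -/
def IsEnvelope (C : ModuleCat.{u} R → Prop) {M E : ModuleCat.{u} R} (φ : M →ₗ[R] E) : Prop :=
  IsPreenvelope C φ ∧ ∀ g : E →ₗ[R] E, g ∘ₗ φ = φ → Function.Bijective g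

/-- `M` has an epimorphic `C`-envelope: a `C`-envelope that is surjective. -/
def HasEpimorphicEnvelope (C : ModuleCat.{u} R → Prop) (M : ModuleCat.{u} R) : Prop :=
  ∃ (E : ModuleCat.{u} R) (φ : M →ₗ[R] E), IsEnvelope C φ ∧ Function.Surjective φ

/-- The class `C` is closed under submodules. -/
def IsClosedUnderSubmodules (C : ModuleCat.{u} R → Prop) : Prop :=
  ∀ M : ModuleCat.{u} R, C M → ∀ N : Submodule R M, C (ModuleCat.of R N)

/-- The class `C` is closed under (set-indexed) direct products. -/
def IsClosedUnderDirectProducts (C : ModuleCat.{u} R → Prop) : Prop :=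
  ∀ (ι : Type u) (M : ι → ModuleCat.{u} R), (∀ i, C (M i)) → C (ModuleCat.of R (∀ i, M i))

/-- A pretorsion-free class: a class of modules closed under submodules and direct products. -/
def IsPretorsionFreeClass (C : ModuleCat.{u} R → Prop) : Prop :=
  IsClosedUnderSubmodules C ∧ IsClosedUnderDirectProducts C

end Classes

/-!
For `P` projective, `Tor_1(P / K, M) = 0` says that `K ⊗ M → P ⊗ M` is injective, so for `n ≥ 2`
the `FP_n`-flat modules are tested on finitely presented `K`. Since `K ⊗ -` then commutes with
products, they are closed under products. If `K` is finitely generated projective, then `K ⊗ -` is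
exact, and injectivity of `K ⊗ M → P ⊗ M` passes to the submodules of `M`. Conversely, duals
`F* = Hom(F, R)` of finitely generated projectives are `FP_n`-flat; if all their submodules are
too, then `K ⊗ -` preserves the inclusions `N ⊆ F*`, and for a presentation
`F₁ → F₀ → K → 0` the sequence `K ⊗ K* → K ⊗ F₀* → K ⊗ F₁*` is exact. As
`K ⊗ Fᵢ* = Hom(Fᵢ, K)`, the surjection `F₀ → K` comes from an element of `K ⊗ K*`, which provides a
dual basis of `K`.

If a class of modules is closed under submodules and products, then the image of `M` in the product
of those of its quotients that belong to the class is an epimorphic envelope of `M`. Conversely, an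
epimorphic envelope of a submodule of a module in the class is injective, hence an isomorphism.
-/

theorem exact_quotientAddGroupMap {A B C : Type*} [AddCommGroup A] [AddCommGroup B] [AddCommGroup C]
    {A' : AddSubgroup A} {B' : AddSubgroup B} {C' : AddSubgroup C} {f : A →+ B} {g : B →+ C}
    (hf : A' ≤ B'.comap f) (hg : B' ≤ C'.comap g) (hfg : Function.Exact f g) (hC : C' ≤ B'.map g) :
    Function.Exact (QuotientAddGroup.map A' B' f hf) (QuotientAddGroup.map B' C' g hg) := by
  intro y
  obtain ⟨b, rfl⟩ := QuotientAddGroup.mk_surjective y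
  constructor
  · intro hb
    obtain ⟨b', hb', hgb⟩ := hC ((QuotientAddGroup.eq_zero_iff _).1 hb)
    obtain ⟨a, ha⟩ := (hfg (b - b')).1 (by rw [map_sub, hgb, sub_self])
    refine ⟨QuotientAddGroup.mk a, QuotientAddGroup.eq_iff_sub_mem.2 ?_⟩
    rw [ha, sub_sub_cancel_left]
    exact neg_mem hb'
  · rintro ⟨x, hx⟩
    obtain ⟨a, rfl⟩ := QuotientAddGroup.mk_surjective x
    rw [← hx, QuotientAddGroup.map_mk, QuotientAddGroup.map_mk, hfg.apply_apply_eq_zero,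
      QuotientAddGroup.mk_zero]

theorem exact_piMap {ι : Type*} {A B C : ι → Type*} [∀ i, AddCommGroup (A i)]
    [∀ i, AddCommGroup (B i)] [∀ i, AddCommGroup (C i)] {f : ∀ i, A i →+ B i}
    {g : ∀ i, B i →+ C i} (h : ∀ i, Function.Exact (f i) (g i)) :
    Function.Exact (AddMonoidHom.piMap f) (AddMonoidHom.piMap g) := by
  intro b
  simp only [funext_iff, AddMonoidHom.piMap_apply, Pi.zero_apply, Set.mem_range]
  exact (forall_congr' fun i => h i (b i)).trans (Classical.skolem (p := fun i a => f i a = b i))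

theorem exact_lcomp {S A B C : Type*} [Ring S] [AddCommGroup A] [Module S A] [AddCommGroup B]
    [Module S B] [AddCommGroup C] [Module S C] (T D : Type*) [Semiring T] [AddCommGroup D]
    [Module S D] [Module T D] [SMulCommClass S T D] {f : A →ₗ[S] B} {g : B →ₗ[S] C}
    (hfg : Function.Exact f g) (hg : Function.Surjective g) :
    Function.Exact (g.lcomp T D) (f.lcomp T D) := by
  intro φ
  constructor
  · intro hφ
    refine ⟨(LinearMap.range f).liftQ φ (LinearMap.range_le_ker_iff.2 hφ) ∘ₗ
      (hfg.linearEquivOfSurjective hg).symm.toLinearMap, LinearMap.ext fun x => ?_⟩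
    simp
  · rintro ⟨ψ, rfl⟩
    ext x
    simp [hfg.apply_apply_eq_zero]

section Tensor

variable {R : Type u} [Ring R]

namespace BalancedTensor

variable {X Y Z : Type u} [AddCommGroup X] [Module Rᵐᵒᵖ X] [AddCommGroup Y] [Module Rᵐᵒᵖ Y]
  [AddCommGroup Z] [Module Rᵐᵒᵖ Z]
  {L M N : Type u} [AddCommGroup L] [Module R L] [AddCommGroup M] [Module R M]
  [AddCommGroup N] [Module R N]

/-- The class of `x ⊗ m` in `X ⊗_R M`. -/
def tmul (x : X) (m : M) : BalancedTensor R X M :=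
  QuotientAddGroup.mk (x ⊗ₜ[ℤ] m)

theorem add_tmul (x y : X) (m : M) :
    (tmul (x + y) m : BalancedTensor R X M) = tmul x m + tmul y m :=
  congrArg (QuotientAddGroup.mk (s := balancedRelations R X M)) (TensorProduct.add_tmul x y m)

theorem tmul_add (x : X) (m n : M) :
    (tmul x (m + n) : BalancedTensor R X M) = tmul x m + tmul x n :=
  congrArg (QuotientAddGroup.mk (s := balancedRelations R X M)) (TensorProduct.tmul_add x m n)

theorem smul_tmul (r : R) (x : X) (m : M) :
    (tmul (MulOpposite.op r • x) m : BalancedTensor R X M) = tmul x (r • m) :=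
  QuotientAddGroup.eq_iff_sub_mem.2 (AddSubgroup.subset_closure ⟨x, r, m, rfl⟩)

/-- The universal biadditive map `(x, m) ↦ x ⊗ m`, for transporting finite sums. -/
def tmulHom (X M : Type u) [AddCommGroup X] [Module Rᵐᵒᵖ X] [AddCommGroup M] [Module R M] :
    X →+ M →+ BalancedTensor R X M :=
  AddMonoidHom.mk' (fun x => AddMonoidHom.mk' (tmul x) (tmul_add x))
    fun x y => AddMonoidHom.ext (add_tmul x y)

theorem sum_tmul {ι : Type*} (s : Finset ι) (x : ι → X) (m : M) :
    (tmul (∑ i ∈ s, x i) m : BalancedTensor R X M) = ∑ i ∈ s, tmul (x i) m :=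
  map_sum ((tmulHom X M).flip m) x s

theorem tmul_sum {ι : Type*} (s : Finset ι) (x : X) (m : ι → M) :
    (tmul x (∑ i ∈ s, m i) : BalancedTensor R X M) = ∑ i ∈ s, tmul x (m i) :=
  map_sum (tmulHom X M x) m s

theorem zero_tmul (m : M) : (tmul (0 : X) m : BalancedTensor R X M) = 0 :=
  map_zero ((tmulHom X M).flip m)

theorem tmul_zero (x : X) : (tmul x (0 : M) : BalancedTensor R X M) = 0 :=
  map_zero (tmulHom X M x)

@[elab_as_elim]
theorem induction_on {p : BalancedTensor R X M → Prop} (t : BalancedTensor R X M)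
    (zero : p 0) (tmul : ∀ x m, p (tmul x m)) (add : ∀ s t, p s → p t → p (s + t)) : p t := by
  obtain ⟨t, rfl⟩ := QuotientAddGroup.mk_surjective t
  induction t using TensorProduct.induction_on with
  | zero => exact zero
  | tmul x m => exact tmul x m
  | add a b ha hb => exact add _ _ ha hb

theorem exists_sum_tmul (t : BalancedTensor R X M) :
    ∃ (k : ℕ) (x : Fin k → X) (m : Fin k → M), t = ∑ i, tmul (x i) (m i) := by
  induction t using induction_on with
  | zero => exact ⟨0, Fin.elim0, Fin.elim0, by rw [Fin.sum_univ_zero]⟩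
  | tmul x m => exact ⟨1, fun _ => x, fun _ => m, by rw [Fin.sum_univ_one]⟩
  | add s t hs ht =>
    obtain ⟨k, x, m, rfl⟩ := hs
    obtain ⟨l, y, n, rfl⟩ := ht
    exact ⟨k + l, Fin.append x y, Fin.append m n, by simp [Fin.sum_univ_add]⟩

/-- The additive map out of `X ⊗_R M` given by a balanced biadditive map. -/
def lift {A : Type*} [AddCommGroup A] (f : X →+ M →+ A)
    (hf : ∀ x (r : R) m, f (MulOpposite.op r • x) m = f x (r • m)) : BalancedTensor R X M →+ A :=
  QuotientAddGroup.lift _ (TensorProduct.liftAddHom f fun r x m => by simp) (by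
    refine (AddSubgroup.closure_le _).2 ?_
    rintro _ ⟨x, r, m, rfl⟩
    change TensorProduct.liftAddHom f _ _ = 0
    rw [map_sub, TensorProduct.liftAddHom_tmul, TensorProduct.liftAddHom_tmul, hf, sub_self])

/-- The map `X ⊗_R g : X ⊗_R M → X ⊗_R N` induced by a map `g : M → N` of left modules. -/
def mapRight (X : Type u) [AddCommGroup X] [Module Rᵐᵒᵖ X] (g : M →ₗ[R] N) :
    BalancedTensor R X M →+ BalancedTensor R X N :=
  QuotientAddGroup.map _ _
    (LinearMap.lTensor X g.toAddMonoidHom.toIntLinearMap).toAddMonoidHom (by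
    refine (AddSubgroup.closure_le _).2 ?_
    rintro _ ⟨x, r, m, rfl⟩
    refine AddSubgroup.subset_closure ⟨x, r, g m, ?_⟩
    rw [map_sub, ← g.map_smul]
    rfl)

@[simp]
theorem map_tmul (f : X →ₗ[Rᵐᵒᵖ] Y) (x : X) (m : M) : map M f (tmul x m) = tmul (f x) m := rfl

@[simp]
theorem mapRight_tmul (g : M →ₗ[R] N) (x : X) (m : M) :
    mapRight X g (tmul x m) = tmul x (g m) := rfl

theorem map_comp (g : Y →ₗ[Rᵐᵒᵖ] Z) (f : X →ₗ[Rᵐᵒᵖ] Y) :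
    map M (g ∘ₗ f) = (map M g).comp (map M f) :=
  hom_ext fun _ _ => rfl

theorem map_id : map M (LinearMap.id : X →ₗ[Rᵐᵒᵖ] X) = AddMonoidHom.id _ :=
  hom_ext fun _ _ => rfl

theorem map_sub (f g : X →ₗ[Rᵐᵒᵖ] Y) : map M (f - g) = map M f - map M g :=
  hom_ext fun x m => congrArg (QuotientAddGroup.mk (s := balancedRelations R Y M))
    (TensorProduct.sub_tmul (f x) (g x) m)

theorem mapRight_comp (g : M →ₗ[R] N) (f : L →ₗ[R] M) :
    mapRight X (g ∘ₗ f) = (mapRight X g).comp (mapRight X f) :=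
  hom_ext fun _ _ => rfl

theorem mapRight_id : mapRight X (LinearMap.id : M →ₗ[R] M) = AddMonoidHom.id _ :=
  hom_ext fun _ _ => rfl

theorem map_comp_mapRight (f : X →ₗ[Rᵐᵒᵖ] Y) (g : M →ₗ[R] N) :
    (map N f).comp (mapRight X g) = (mapRight Y g).comp (map M f) :=
  hom_ext fun _ _ => rfl

theorem map_injective_of_mapRight_injective {f : X →ₗ[Rᵐᵒᵖ] Y} {g : M →ₗ[R] N}
    (hf : Function.Injective (map N f)) (hg : Function.Injective (mapRight X g)) :
    Function.Injective (map M f) := by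
  refine .of_comp (f := mapRight Y g) ?_
  rw [← AddMonoidHom.coe_comp, ← map_comp_mapRight]
  exact hf.comp hg

theorem mapRight_injective_of_map_injective {f : X →ₗ[Rᵐᵒᵖ] Y} {g : M →ₗ[R] N}
    (hg : Function.Injective (mapRight Y g)) (hf : Function.Injective (map M f)) :
    Function.Injective (mapRight X g) := by
  refine .of_comp (f := map N f) ?_
  rw [← AddMonoidHom.coe_comp, map_comp_mapRight]
  exact hg.comp hf

theorem mapRight_injective_of_comp_eq_id {f : M →ₗ[R] N} {g : N →ₗ[R] M}
    (h : g ∘ₗ f = LinearMap.id) : Function.Injective (mapRight X f) := by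
  refine .of_comp (f := mapRight X g) ?_
  rw [← AddMonoidHom.coe_comp, ← mapRight_comp, h, mapRight_id]
  exact Function.injective_id

theorem map_surjective {f : X →ₗ[Rᵐᵒᵖ] Y} (hf : Function.Surjective f) :
    Function.Surjective (map M f) :=
  QuotientAddGroup.map_surjective_of_surjective _ _ _
    ((QuotientAddGroup.mk_surjective).comp (LinearMap.rTensor_surjective M hf)) _

theorem map_exact {f : X →ₗ[Rᵐᵒᵖ] Y} {g : Y →ₗ[Rᵐᵒᵖ] Z} (hfg : Function.Exact f g)
    (hg : Function.Surjective g) : Function.Exact (map M f) (map M g) := by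
  refine exact_quotientAddGroupMap _ _
    (rTensor_exact M (f := f.toAddMonoidHom.toIntLinearMap)
      (g := g.toAddMonoidHom.toIntLinearMap) hfg hg) ((AddSubgroup.closure_le _).2 ?_)
  rintro _ ⟨z, r, m, rfl⟩
  obtain ⟨y, rfl⟩ := hg z
  refine ⟨_, AddSubgroup.subset_closure ⟨y, r, m, rfl⟩, ?_⟩
  rw [_root_.map_sub, ← g.map_smul]
  rfl

theorem mapRight_exact {f : L →ₗ[R] M} {g : M →ₗ[R] N} (hfg : Function.Exact f g)
    (hg : Function.Surjective g) : Function.Exact (mapRight X f) (mapRight X g) := by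
  refine exact_quotientAddGroupMap _ _
    (lTensor_exact X (f := f.toAddMonoidHom.toIntLinearMap)
      (g := g.toAddMonoidHom.toIntLinearMap) hfg hg) ((AddSubgroup.closure_le _).2 ?_)
  rintro _ ⟨x, r, n, rfl⟩
  obtain ⟨m, rfl⟩ := hg n
  refine ⟨_, AddSubgroup.subset_closure ⟨x, r, m, rfl⟩, ?_⟩
  rw [_root_.map_sub, ← g.map_smul]
  rfl

theorem mapRight_exact_of_range_subtype_injective {f : L →ₗ[R] M} {g : M →ₗ[R] N}
    (hfg : Function.Exact f g)
    (hg : Function.Injective (mapRight X (LinearMap.range g).subtype)) :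
    Function.Exact (mapRight X f) (mapRight X g) := by
  have hfr : Function.Exact f g.rangeRestrict := by
    rwa [LinearMap.exact_iff, LinearMap.ker_rangeRestrict, ← LinearMap.exact_iff]
  have hex := (mapRight_exact (X := X) hfr g.surjective_rangeRestrict).comp_injective _ hg
    (map_zero _)
  rwa [← AddMonoidHom.coe_comp, ← mapRight_comp] at hex

end BalancedTensor

end Tensor

section Duality

variable {R : Type u} [Ring R]

/-- The dual `F* = Hom_R(F, R)` of a right `R`-module `F`, a left `R`-module through
`(r • φ) v = r * φ v`. -/
abbrev RightDual (R : Type u) [Ring R] (F : Type u) [AddCommGroup F] [Module Rᵐᵒᵖ F] : Type u :=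
  F →ₗ[Rᵐᵒᵖ] R

variable {F G X Y : Type u} [AddCommGroup F] [Module Rᵐᵒᵖ F] [AddCommGroup G] [Module Rᵐᵒᵖ G]
  [AddCommGroup X] [Module Rᵐᵒᵖ X] [AddCommGroup Y] [Module Rᵐᵒᵖ Y]
  {M N : Type u} [AddCommGroup M] [Module R M] [AddCommGroup N] [Module R N]

namespace BalancedTensor

/-- The canonical map `X ⊗_R F* → Hom_R(F, X)`, `x ⊗ φ ↦ (v ↦ x · φ v)`. -/
def tensorDualHom (X F : Type u) [AddCommGroup X] [Module Rᵐᵒᵖ X] [AddCommGroup F]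
    [Module Rᵐᵒᵖ F] : BalancedTensor R X (RightDual R F) →+ (F →ₗ[Rᵐᵒᵖ] X) :=
  lift
    (AddMonoidHom.mk'
      (fun x => AddMonoidHom.mk'
        (fun φ => (LinearMap.toSpanSingleton Rᵐᵒᵖ X x) ∘ₗ
          (MulOpposite.opLinearEquiv Rᵐᵒᵖ).toLinearMap ∘ₗ φ)
        fun φ ψ => LinearMap.ext fun v => by simp [add_smul])
      fun x y => AddMonoidHom.ext fun φ => LinearMap.ext fun v => by simp)
    fun x r φ => LinearMap.ext fun v => by simp [mul_smul]

@[simp]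
theorem tensorDualHom_tmul (x : X) (φ : RightDual R F) (v : F) :
    tensorDualHom X F (tmul x φ) v = MulOpposite.op (φ v) • x := rfl

theorem tensorDualHom_map (f : X →ₗ[Rᵐᵒᵖ] Y) (t : BalancedTensor R X (RightDual R F)) :
    tensorDualHom Y F (map _ f t) = f ∘ₗ tensorDualHom X F t := by
  induction t using induction_on with
  | zero => simp
  | tmul x φ => ext v; simp
  | add s t hs ht => simp [hs, ht, LinearMap.comp_add]

theorem tensorDualHom_mapRight_lcomp (f : F →ₗ[Rᵐᵒᵖ] G)
    (t : BalancedTensor R X (RightDual R G)) :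
    tensorDualHom X F (mapRight X (f.lcomp R R) t) = tensorDualHom X G t ∘ₗ f := by
  induction t using induction_on with
  | zero => simp
  | tmul x φ => ext v; simp
  | add s t hs ht => simp [hs, ht, LinearMap.add_comp]

/-- The canonical map `F ⊗_R M → Hom_R(F*, M)`, `v ⊗ m ↦ (φ ↦ φ v • m)`. -/
def tensorEvalHom (F M : Type u) [AddCommGroup F] [Module Rᵐᵒᵖ F] [AddCommGroup M]
    [Module R M] : BalancedTensor R F M →+ (RightDual R F →ₗ[R] M) :=
  lift
    (AddMonoidHom.mk'
      (fun v => AddMonoidHom.mk'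
        (fun m => (LinearMap.toSpanSingleton R M m) ∘ₗ (LinearMap.applyₗ' R v))
        fun m n => LinearMap.ext fun φ => by simp)
      fun v w => AddMonoidHom.ext fun m => LinearMap.ext fun φ => by simp [add_smul])
    fun v r m => LinearMap.ext fun φ => by simp [mul_smul]

@[simp]
theorem tensorEvalHom_tmul (v : F) (m : M) (φ : RightDual R F) :
    tensorEvalHom F M (tmul v m) φ = φ v • m := rfl

theorem tensorEvalHom_mapRight (g : M →ₗ[R] N) (t : BalancedTensor R F M) :
    tensorEvalHom F N (mapRight F g t) = g ∘ₗ tensorEvalHom F M t := by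
  induction t using induction_on with
  | zero => simp
  | tmul v m => ext φ; simp
  | add s t hs ht => simp [hs, ht, LinearMap.comp_add]

end BalancedTensor

open BalancedTensor

/-- Vectors `v i` of a right module `F` and functionals `φ i` on `F` form a (finite) dual basis if
`x = ∑ i, v i · φ i x` for all `x`. The vectors need not be linearly independent. -/
def IsDualBasis {ι : Type*} [Fintype ι] (v : ι → F) (φ : ι → RightDual R F) : Prop :=
  ∀ x, ∑ i, MulOpposite.op (φ i x) • v i = x

theorem exists_isDualBasis (R : Type u) [Ring R] (F : Type u) [AddCommGroup F] [Module Rᵐᵒᵖ F]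
    [Module.Finite Rᵐᵒᵖ F] [Module.Projective Rᵐᵒᵖ F] :
    ∃ (k : ℕ) (v : Fin k → F) (φ : Fin k → RightDual R F), IsDualBasis v φ := by
  obtain ⟨k, π, hπ⟩ := Module.Finite.exists_fin' Rᵐᵒᵖ F
  obtain ⟨s, hs⟩ := π.exists_rightInverse_of_surjective (LinearMap.range_eq_top.2 hπ)
  refine ⟨k, fun i => π (Pi.single i 1), fun i =>
    (MulOpposite.opLinearEquiv Rᵐᵒᵖ).symm.toLinearMap ∘ₗ LinearMap.proj i ∘ₗ s, fun x => ?_⟩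
  calc ∑ i, s x i • π (Pi.single i 1) = π (∑ i, s x i • Pi.single i 1) := by
        simp only [map_sum, map_smul]
    _ = π (s x) := by rw [← pi_eq_sum_univ' (s x)]
    _ = x := LinearMap.congr_fun hs x

namespace IsDualBasis

variable {ι : Type*} [Fintype ι] {v : ι → F} {φ : ι → RightDual R F}

theorem sum_apply_smul (h : IsDualBasis v φ) (ψ : RightDual R F) : ∑ i, ψ (v i) • φ i = ψ := by
  ext x
  conv_rhs => rw [← h x, map_sum]
  simp

theorem projective (h : IsDualBasis v φ) : Module.Projective Rᵐᵒᵖ F :=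
  .of_split
    (LinearMap.pi fun i => (MulOpposite.opLinearEquiv Rᵐᵒᵖ).toLinearMap ∘ₗ φ i)
    (Fintype.linearCombination Rᵐᵒᵖ v) (LinearMap.ext h)

theorem sum_tmul_tensorDualHom (h : IsDualBasis v φ) (t : BalancedTensor R X (RightDual R F)) :
    ∑ i, tmul (tensorDualHom X F t (v i)) (φ i) = t := by
  induction t using induction_on with
  | zero => simp [zero_tmul]
  | tmul x ψ => simp only [tensorDualHom_tmul, smul_tmul, ← tmul_sum, h.sum_apply_smul]
  | add s t hs ht =>
    simp only [map_add, LinearMap.add_apply, add_tmul, Finset.sum_add_distrib, hs, ht]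

theorem sum_tmul_tensorEvalHom (h : IsDualBasis v φ) (t : BalancedTensor R F M) :
    ∑ i, tmul (v i) (tensorEvalHom F M t (φ i)) = t := by
  induction t using induction_on with
  | zero => simp [tmul_zero]
  | tmul x m => simp only [tensorEvalHom_tmul, ← smul_tmul, ← sum_tmul, h x]
  | add s t hs ht =>
    simp only [map_add, LinearMap.add_apply, tmul_add, Finset.sum_add_distrib, hs, ht]

end IsDualBasis

namespace BalancedTensor

section FiniteProjective

variable [Module.Finite Rᵐᵒᵖ F] [Module.Projective Rᵐᵒᵖ F]

theorem tensorDualHom_bijective :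
    Function.Bijective (tensorDualHom (R := R) X F) := by
  obtain ⟨k, v, φ, h⟩ := exists_isDualBasis R F
  refine ⟨fun s t hst => ?_, fun f => ⟨∑ i, tmul (f (v i)) (φ i), LinearMap.ext fun x => ?_⟩⟩
  · rw [← h.sum_tmul_tensorDualHom s, hst, h.sum_tmul_tensorDualHom]
  · conv_rhs => rw [← h x]
    simp

theorem tensorEvalHom_bijective :
    Function.Bijective (tensorEvalHom (R := R) F M) := by
  obtain ⟨k, v, φ, h⟩ := exists_isDualBasis R F
  refine ⟨fun s t hst => ?_, fun f => ⟨∑ i, tmul (v i) (f (φ i)), LinearMap.ext fun ψ => ?_⟩⟩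
  · rw [← h.sum_tmul_tensorEvalHom s, hst, h.sum_tmul_tensorEvalHom]
  · conv_rhs => rw [← h.sum_apply_smul ψ]
    simp

end FiniteProjective

theorem projective_of_id_mem_range_tensorDualHom
    (h : LinearMap.id ∈ (tensorDualHom (R := R) X X).range) : Module.Projective Rᵐᵒᵖ X := by
  obtain ⟨t, ht⟩ := h
  obtain ⟨k, x, φ, rfl⟩ := exists_sum_tmul t
  refine IsDualBasis.projective (v := x) (φ := φ) fun y => ?_
  simpa using LinearMap.congr_fun ht y

end BalancedTensor

end Duality

section Flatness

variable {R : Type u} [Ring R] {F X Y : Type u} [AddCommGroup F] [Module Rᵐᵒᵖ F]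
  [AddCommGroup X] [Module Rᵐᵒᵖ X] [AddCommGroup Y]
  [Module Rᵐᵒᵖ Y] {M N : Type u} [AddCommGroup M] [Module R M] [AddCommGroup N] [Module R N]

namespace BalancedTensor

theorem mapRight_injective [Module.Finite Rᵐᵒᵖ F] [Module.Projective Rᵐᵒᵖ F] {g : M →ₗ[R] N}
    (hg : Function.Injective g) : Function.Injective (mapRight F g) := by
  intro s t hst
  refine tensorEvalHom_bijective.1 ((LinearMap.cancel_left hg).1 ?_)
  rw [← tensorEvalHom_mapRight, hst, tensorEvalHom_mapRight]

theorem map_rightDual_injective [Module.Finite Rᵐᵒᵖ F] [Module.Projective Rᵐᵒᵖ F]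
    {f : X →ₗ[Rᵐᵒᵖ] Y} (hf : Function.Injective f) :
    Function.Injective (map (RightDual R F) f) := by
  intro s t hst
  refine tensorDualHom_bijective.1 ((LinearMap.cancel_left hf).1 ?_)
  rw [← tensorDualHom_map, hst, tensorDualHom_map]

/-- The canonical map `X ⊗_R ∏ i, M i → ∏ i, X ⊗_R M i`. -/
def piHom {ι : Type u} (X : Type u) [AddCommGroup X] [Module Rᵐᵒᵖ X] (M : ι → Type u)
    [∀ i, AddCommGroup (M i)] [∀ i, Module R (M i)] :
    BalancedTensor R X (∀ i, M i) →+ ∀ i, BalancedTensor R X (M i) :=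
  AddMonoidHom.pi fun i => mapRight X (LinearMap.proj i)

variable {ι : Type u} {Q : ι → Type u} [∀ i, AddCommGroup (Q i)] [∀ i, Module R (Q i)]

theorem piHom_comp_map (f : X →ₗ[Rᵐᵒᵖ] Y) :
    (piHom Y Q).comp (map _ f) = (AddMonoidHom.piMap fun i => map (Q i) f).comp (piHom X Q) :=
  hom_ext fun _ _ => rfl

theorem tensorEvalHom_piHom (t : BalancedTensor R X (∀ i, Q i)) (i : ι) :
    tensorEvalHom X (Q i) (piHom X Q t i) = LinearMap.proj i ∘ₗ tensorEvalHom X _ t :=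
  tensorEvalHom_mapRight _ t

theorem piHom_bijective_of_projective [Module.Finite Rᵐᵒᵖ F] [Module.Projective Rᵐᵒᵖ F] :
    Function.Bijective (piHom (R := R) F Q) := by
  constructor
  · intro s t hst
    refine tensorEvalHom_bijective.1 (LinearMap.ext fun φ => funext fun i => ?_)
    have := tensorEvalHom_piHom s i
    rw [hst, tensorEvalHom_piHom] at this
    exact (LinearMap.congr_fun this φ).symm
  · intro u
    obtain ⟨t, ht⟩ := tensorEvalHom_bijective.2
      (LinearMap.pi fun i => tensorEvalHom F (Q i) (u i))
    refine ⟨t, funext fun i => tensorEvalHom_bijective.1 ?_⟩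
    rw [tensorEvalHom_piHom, ht, LinearMap.proj_pi]

theorem piHom_bijective [Module.FinitePresentation Rᵐᵒᵖ X] :
    Function.Bijective (piHom (R := R) X Q) := by
  obtain ⟨n, m, π, ρ, hπ, hex⟩ := Module.FinitePresentation.exists_fin' Rᵐᵒᵖ X
  exact AddMonoidHom.bijective_of_surjective_of_bijective_of_right_exact
    (map _ ρ) (map _ π) (AddMonoidHom.piMap fun i => map (Q i) ρ)
    (AddMonoidHom.piMap fun i => map (Q i) π) (piHom _ Q) (piHom _ Q) (piHom X Q)
    (piHom_comp_map ρ).symm (piHom_comp_map π).symm (map_exact hex hπ)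
    (exact_piMap fun _ => map_exact hex hπ) piHom_bijective_of_projective.2
    piHom_bijective_of_projective (map_surjective hπ)
    (Function.Surjective.piMap fun _ => map_surjective hπ)

theorem projective_of_mapRight_subtype_injective [Module.FinitePresentation Rᵐᵒᵖ X]
    (h : ∀ (F : Type u) [AddCommGroup F] [Module Rᵐᵒᵖ F] [Module.Finite Rᵐᵒᵖ F]
      [Module.Projective Rᵐᵒᵖ F] (N : Submodule R (RightDual R F)),
      Function.Injective (mapRight X (M := N) N.subtype)) :
    Module.Projective Rᵐᵒᵖ X := by
  obtain ⟨n, m, π, ρ, hπ, hex⟩ := Module.FinitePresentation.exists_fin' Rᵐᵒᵖ X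
  obtain ⟨t, ht⟩ := tensorDualHom_bijective.2 π
  have ht0 : mapRight X (ρ.lcomp R R) t = 0 := by
    refine tensorDualHom_bijective.1 ?_
    rw [tensorDualHom_mapRight_lcomp, ht, hex.linearMap_comp_eq_zero, map_zero]
  obtain ⟨s, rfl⟩ := (mapRight_exact_of_range_subtype_injective
    (exact_lcomp R R hex hπ) (h _ _) t).1 ht0
  refine projective_of_id_mem_range_tensorDualHom ⟨s, (LinearMap.cancel_right hπ).1 ?_⟩
  rw [← tensorDualHom_mapRight_lcomp, ht, LinearMap.id_comp]

end BalancedTensor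

end Flatness

section FinitelyPresented

variable {S : Type u} [Ring S] {M P : Type u} [AddCommGroup M] [Module S M] [AddCommGroup P]
  [Module S P] {n : ℕ}

namespace IsFinitelyNPresented

theorem finite (h : IsFinitelyNPresented S n M) : Module.Finite S M := by
  obtain ⟨F, d, ε, hF, hε, -⟩ := h
  have := (hF 0 (Nat.zero_le n)).1
  exact .of_surjective ε hε

theorem exists_ker (h : IsFinitelyNPresented S (n + 1) M) :
    ∃ (P : ModuleCat.{u} S) (ε : P →ₗ[S] M), Module.Finite S P ∧ Module.Projective S P ∧
      Function.Surjective ε ∧ IsFinitelyNPresented S n (LinearMap.ker ε) := by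
  obtain ⟨F, d, ε, hF, hε, hd, hdd⟩ := h
  have hex := hd (Nat.le_add_left _ _)
  refine ⟨F 0, ε, (hF 0 (Nat.zero_le _)).1, (hF 0 (Nat.zero_le _)).2, hε,
    fun i => F (i + 1), fun i => d (i + 1),
    (d 0).codRestrict _ fun x => hex.apply_apply_eq_zero x,
    fun i hi => hF _ (Nat.succ_le_succ hi), ?_, fun hn => ?_, fun i hi => hdd _ (by omega)⟩
  · rintro ⟨x, hx⟩
    obtain ⟨y, rfl⟩ := (hex x).1 hx
    exact ⟨y, rfl⟩
  · intro x
    rw [← hdd 0 (by omega) x, ← Submodule.coe_eq_zero]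
    rfl

theorem finitePresentation (h : IsFinitelyNPresented S (n + 1) M) :
    Module.FinitePresentation S M := by
  obtain ⟨P, ε, _, _, hε, hK⟩ := h.exists_ker
  have := Module.finitePresentation_of_projective S P
  exact Module.finitePresentation_of_surjective ε hε (Module.Finite.iff_fg.1 hK.finite)

theorem quotient [Module.Finite S P] [Module.Projective S P] {K : Submodule S P}
    (h : IsFinitelyNPresented S n K) : IsFinitelyNPresented S (n + 1) (P ⧸ K) := by
  obtain ⟨F, d, ε, hF, hε, hd, hdd⟩ := h
  refine ⟨fun i => Nat.casesOn i (ModuleCat.of S P) F,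
    fun i => match i with
      | 0 => K.subtype ∘ₗ ε
      | i + 1 => d i, K.mkQ, ?_, K.mkQ_surjective, fun _ => ?_, ?_⟩
  · rintro (_ | i) hi
    · exact ⟨‹_›, ‹_›⟩
    · exact hF i (Nat.le_of_succ_le_succ hi)
  · change Function.Exact (K.subtype ∘ₗ ε) K.mkQ
    rw [LinearMap.exact_iff, Submodule.ker_mkQ, LinearMap.range_comp, LinearMap.range_eq_top.2 hε,
      Submodule.map_top, Submodule.range_subtype]
  · rintro (_ | i) hi
    · exact (hd (by omega)).comp_injective _ K.subtype_injective (map_zero _)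
    · exact hdd i (by omega)

end IsFinitelyNPresented

end FinitelyPresented

section Tor

variable {R : Type u} [Ring R]

namespace BalancedTensor

variable {M : Type u} [AddCommGroup M] [Module R M] {X P Q P₀ P₁ P₂ : Type u}
  [AddCommGroup X] [Module Rᵐᵒᵖ X] [AddCommGroup P] [Module Rᵐᵒᵖ P] [AddCommGroup Q]
  [Module Rᵐᵒᵖ Q] [AddCommGroup P₀] [Module Rᵐᵒᵖ P₀] [AddCommGroup P₁] [Module Rᵐᵒᵖ P₁]
  [AddCommGroup P₂] [Module Rᵐᵒᵖ P₂]

-- As in Schanuel's lemma: lift `η` to `a : Q → P` and `ε` to `b : P → Q`. Then `b ∘ a - 1` maps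
-- `Q` into `ker η`, so on the kernel of `ker η ⊗ M → Q ⊗ M` the identity agrees with a map
-- factoring through `ker ε ⊗ M`, where `a` kills that kernel.
theorem map_ker_subtype_injective [Module.Projective Rᵐᵒᵖ P] [Module.Projective Rᵐᵒᵖ Q]
    {ε : P →ₗ[Rᵐᵒᵖ] X} (hε : Function.Surjective ε) {η : Q →ₗ[Rᵐᵒᵖ] X}
    (hη : Function.Surjective η) (h : Function.Injective (map M (LinearMap.ker ε).subtype)) :
    Function.Injective (map M (LinearMap.ker η).subtype) := by
  obtain ⟨a, ha⟩ := Module.projective_lifting_property ε η hε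
  obtain ⟨b, hb⟩ := Module.projective_lifting_property η ε hη
  have ha' (x : Q) : ε (a x) = η x := LinearMap.congr_fun ha x
  have hb' (x : P) : η (b x) = ε x := LinearMap.congr_fun hb x
  let a' : LinearMap.ker η →ₗ[Rᵐᵒᵖ] LinearMap.ker ε :=
    a.restrict fun x (hx : η x = 0) => show ε (a x) = 0 by rw [ha', hx]
  let b' : LinearMap.ker ε →ₗ[Rᵐᵒᵖ] LinearMap.ker η :=
    b.restrict fun x (hx : ε x = 0) => show η (b x) = 0 by rw [hb', hx]
  let s : Q →ₗ[Rᵐᵒᵖ] LinearMap.ker η :=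
    LinearMap.codRestrict _ (b ∘ₗ a - LinearMap.id) fun x => by simp [ha', hb']
  refine (injective_iff_map_eq_zero _).2 fun t ht => ?_
  have hat : map M a' t = 0 := by
    refine (map_eq_zero_iff _ h).1 ?_
    calc map M (LinearMap.ker ε).subtype (map M a' t)
        = map M a (map M (LinearMap.ker η).subtype t) := by
          simp only [← AddMonoidHom.comp_apply, ← map_comp]
          rfl
      _ = 0 := by rw [ht, map_zero]
  calc t = map M b' (map M a' t) - map M s (map M (LinearMap.ker η).subtype t) := by
        have hs : s ∘ₗ (LinearMap.ker η).subtype = b' ∘ₗ a' - LinearMap.id := rfl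
        simp only [← AddMonoidHom.comp_apply, ← map_comp, hs, map_sub, AddMonoidHom.sub_apply,
          map_id, AddMonoidHom.id_apply, sub_sub_cancel]
    _ = 0 := by rw [hat, ht, map_zero, map_zero, sub_zero]

theorem exact_map_iff_injective {f : P₂ →ₗ[Rᵐᵒᵖ] P₁} {g : P₁ →ₗ[Rᵐᵒᵖ] P₀} {ε : P₀ →ₗ[Rᵐᵒᵖ] X}
    (hfg : Function.Exact f g) (hg : Function.Exact g ε) :
    Function.Exact (map M f) (map M g) ↔
      Function.Injective (map M (LinearMap.ker ε).subtype) := by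
  obtain ⟨g', rfl⟩ : ∃ g' : P₁ →ₗ[Rᵐᵒᵖ] LinearMap.ker ε, g = (LinearMap.ker ε).subtype ∘ₗ g' :=
    ⟨g.codRestrict _ fun x => hg.apply_apply_eq_zero x, rfl⟩
  have hg' : Function.Surjective g' := by
    rintro ⟨x, hx⟩
    obtain ⟨y, hy⟩ := (hg x).1 hx
    exact ⟨y, Subtype.ext hy⟩
  have hfg' : Function.Exact f g' := fun x => by
    rw [← hfg x, LinearMap.comp_apply, Submodule.subtype_apply, Submodule.coe_eq_zero]
  have hex : Function.Exact (map M f) (map M g') := map_exact hfg' hg'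
  rw [map_comp, AddMonoidHom.coe_comp]
  constructor
  · intro h
    refine (injective_iff_map_eq_zero _).2 fun t ht => ?_
    obtain ⟨t, rfl⟩ := map_surjective hg' t
    exact (hex t).2 ((h t).1 ht)
  · exact fun h => hex.comp_injective _ h (map_zero _)

end BalancedTensor

open BalancedTensor

theorem isZero_torFunctor_one_iff (M : ModuleCat.{u} R) (X : ModuleCat.{u} Rᵐᵒᵖ) {P : Type u}
    [AddCommGroup P] [Module Rᵐᵒᵖ P] [Module.Projective Rᵐᵒᵖ P] {ε : P →ₗ[Rᵐᵒᵖ] X}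
    (hε : Function.Surjective ε) :
    IsZero ((torFunctor 1 M).obj X) ↔ Function.Injective (map M (LinearMap.ker ε).subtype) := by
  let Q := projectiveResolution X
  have h₁ : Function.Exact (Q.complex.d 2 1).hom (Q.complex.d 1 0).hom :=
    (ShortComplex.ShortExact.moduleCat_exact_iff_function_exact _).1 (Q.exact_succ 0)
  have h₀ : Function.Exact (Q.complex.d 1 0).hom (Q.π.f 0).hom :=
    (ShortComplex.ShortExact.moduleCat_exact_iff_function_exact _).1 Q.exact₀
  have hπ : Function.Surjective (Q.π.f 0).hom := (ModuleCat.epi_iff_surjective _).1 inferInstance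
  have : Module.Projective Rᵐᵒᵖ (Q.complex.X 0) :=
    (IsProjective.iff_projective _).2 (Q.projective 0)
  calc IsZero ((torFunctor 1 M).obj X)
      ↔ IsZero ((((tensorFunctor M).mapHomologicalComplex _).obj Q.complex).homology 1) :=
        (Q.isoLeftDerivedObj (tensorFunctor M) 1).isZero_iff
    _ ↔ Function.Exact (map M (Q.complex.d 2 1).hom) (map M (Q.complex.d 1 0).hom) := by
        rw [← HomologicalComplex.exactAt_iff_isZero_homology,
          HomologicalComplex.exactAt_iff' _ 2 1 0 (by simp) (by simp),
          ShortComplex.ab_exact_iff_function_exact]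
        rfl
    _ ↔ Function.Injective (map M (LinearMap.ker (Q.π.f 0).hom).subtype) :=
        exact_map_iff_injective h₁ h₀
    _ ↔ Function.Injective (map M (LinearMap.ker ε).subtype) :=
        ⟨map_ker_subtype_injective hπ hε, map_ker_subtype_injective hε hπ⟩

end Tor

section FPFlat

variable {R : Type u} [Ring R] {n : ℕ}

open BalancedTensor

theorem isFPFlat_succ_iff {M : ModuleCat.{u} R} :
    IsFPFlat (n + 1) M ↔ ∀ (P : Type u) [AddCommGroup P] [Module Rᵐᵒᵖ P] [Module.Finite Rᵐᵒᵖ P]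
      [Module.Projective Rᵐᵒᵖ P] (K : Submodule Rᵐᵒᵖ P), IsFinitelyNPresented Rᵐᵒᵖ n K →
        Function.Injective (map M K.subtype) := by
  refine ⟨fun h P _ _ _ _ K hK => ?_, fun h X hX => ?_⟩
  · have := (isZero_torFunctor_one_iff M (ModuleCat.of Rᵐᵒᵖ (P ⧸ K)) K.mkQ_surjective).1
      (h _ hK.quotient)
    rwa [Submodule.ker_mkQ] at this
  · obtain ⟨P, ε, _, _, hε, hK⟩ := hX.exists_ker
    exact (isZero_torFunctor_one_iff M X hε).2 (h P _ hK)

theorem IsFPFlat.of_comp_eq_id {M N : ModuleCat.{u} R} (hM : IsFPFlat n M) {f : N →ₗ[R] M}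
    {g : M →ₗ[R] N} (h : g ∘ₗ f = LinearMap.id) : IsFPFlat n N := by
  intro X hX
  have hX' := Finsupp.linearCombination_id_surjective Rᵐᵒᵖ X
  rw [isZero_torFunctor_one_iff N X hX']
  exact map_injective_of_mapRight_injective ((isZero_torFunctor_one_iff M X hX').1 (hM X hX))
    (mapRight_injective_of_comp_eq_id h)

instance IsFPFlat.isClosedUnderIsomorphisms :
    ObjectProperty.IsClosedUnderIsomorphisms (IsFPFlat (R := R) n) where
  of_iso e hM := hM.of_comp_eq_id (f := e.inv.hom) (g := e.hom.hom) (by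
    rw [← ModuleCat.hom_comp, e.inv_hom_id, ModuleCat.hom_id])

theorem isFPFlat_rightDual (F : Type u) [AddCommGroup F] [Module Rᵐᵒᵖ F] [Module.Finite Rᵐᵒᵖ F]
    [Module.Projective Rᵐᵒᵖ F] : IsFPFlat n (ModuleCat.of R (RightDual R F)) := by
  intro X _
  rw [isZero_torFunctor_one_iff _ X (Finsupp.linearCombination_id_surjective Rᵐᵒᵖ X)]
  exact map_rightDual_injective (Submodule.subtype_injective _)

theorem isClosedUnderDirectProducts_isFPFlat :
    IsClosedUnderDirectProducts (IsFPFlat (R := R) (n + 2)) := by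
  intro ι M hM
  refine isFPFlat_succ_iff.2 fun P _ _ _ _ K hK => ?_
  have := hK.finitePresentation
  have hpi : Function.Injective
      ((AddMonoidHom.piMap fun i => map (M i) K.subtype).comp (piHom K fun i => M i)) :=
    (Function.Injective.piMap fun i => isFPFlat_succ_iff.1 (hM i) P K hK).comp piHom_bijective.1
  rw [← piHom_comp_map] at hpi
  exact .of_comp (f := piHom P fun i => M i) hpi

theorem isClosedUnderSubmodules_of_isRightNHereditary (h : IsRightNHereditary R (n + 1)) :
    IsClosedUnderSubmodules (IsFPFlat (R := R) (n + 1)) := by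
  intro M hM N
  refine isFPFlat_succ_iff.2 fun P _ _ _ _ K hK => ?_
  have := hK.finite
  have := h P inferInstance inferInstance K hK
  exact map_injective_of_mapRight_injective (isFPFlat_succ_iff.1 hM P K hK)
    (mapRight_injective N.subtype_injective)

theorem isRightNHereditary_of_isClosedUnderSubmodules
    (h : IsClosedUnderSubmodules (IsFPFlat (R := R) (n + 2))) :
    IsRightNHereditary R (n + 2) := by
  intro P _ _ _ _ K (hK : IsFinitelyNPresented Rᵐᵒᵖ (n + 1) K)
  have := hK.finitePresentation
  refine projective_of_mapRight_subtype_injective fun F _ _ _ _ N => ?_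
  exact mapRight_injective_of_map_injective (mapRight_injective N.subtype_injective)
    (isFPFlat_succ_iff.1 (h _ (isFPFlat_rightDual F) N) P K hK)

end FPFlat

section Envelopes

variable {R : Type u} [Ring R] {C : ModuleCat.{u} R → Prop} {M E : ModuleCat.{u} R}

theorem IsClosedUnderSubmodules.of_injective [ObjectProperty.IsClosedUnderIsomorphisms C]
    (hC : IsClosedUnderSubmodules C) (hE : C E) {f : M →ₗ[R] E} (hf : Function.Injective f) :
    C M :=
  ObjectProperty.prop_of_iso C (LinearEquiv.ofInjective f hf).toModuleIso.symm
    (hC E hE (LinearMap.range f))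

theorem IsPreenvelope.isEnvelope_of_surjective {φ : M →ₗ[R] E} (h : IsPreenvelope C φ)
    (hφ : Function.Surjective φ) : IsEnvelope C φ := by
  refine ⟨h, fun g hg => ?_⟩
  obtain rfl : g = LinearMap.id := (LinearMap.cancel_right hφ).1 hg
  exact Function.bijective_id

theorem isClosedUnderSubmodules_of_hasEpimorphicEnvelope
    [ObjectProperty.IsClosedUnderIsomorphisms C] (h : ∀ M, HasEpimorphicEnvelope C M) :
    IsClosedUnderSubmodules C := by
  intro M hM N
  obtain ⟨E, φ, ⟨⟨hE, hφ⟩, -⟩, hsurj⟩ := h (ModuleCat.of R N)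
  obtain ⟨g, hg⟩ := hφ M hM N.subtype
  have hinj : Function.Injective φ := by
    refine .of_comp (f := g) ?_
    rw [← LinearMap.coe_comp, hg]
    exact N.subtype_injective
  exact ObjectProperty.prop_of_iso C (LinearEquiv.ofBijective φ ⟨hinj, hsurj⟩).toModuleIso.symm hE

theorem IsPretorsionFreeClass.hasEpimorphicEnvelope [ObjectProperty.IsClosedUnderIsomorphisms C]
    (hC : IsPretorsionFreeClass C) (M : ModuleCat.{u} R) : HasEpimorphicEnvelope C M := by
  let ι := {N : Submodule R M // C (ModuleCat.of R (M ⧸ N))}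
  let Φ : M →ₗ[R] ∀ N : ι, M ⧸ N.1 := LinearMap.pi fun N => N.1.mkQ
  have hE : C (ModuleCat.of R (LinearMap.range Φ)) :=
    hC.1 _ (hC.2 ι (fun N => ModuleCat.of R (M ⧸ N.1)) fun N => N.2) _
  refine ⟨ModuleCat.of R (LinearMap.range Φ), Φ.rangeRestrict,
    IsPreenvelope.isEnvelope_of_surjective ⟨hE, fun E' hE' f => ?_⟩ Φ.surjective_rangeRestrict,
    Φ.surjective_rangeRestrict⟩
  let f' : M ⧸ LinearMap.ker f →ₗ[R] E' := (LinearMap.ker f).liftQ f le_rfl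
  have hf : C (ModuleCat.of R (M ⧸ LinearMap.ker f)) :=
    hC.1.of_injective hE' (f := f')
      (LinearMap.ker_eq_bot.1 (Submodule.ker_liftQ_eq_bot _ _ _ le_rfl))
  exact ⟨f' ∘ₗ LinearMap.proj (φ := fun N : ι => M ⧸ N.1) ⟨_, hf⟩ ∘ₗ (LinearMap.range Φ).subtype,
    rfl⟩

end Envelopes

theorem proposition3p8 (R : Type u) [Ring R] (n : ℕ) (hn : 1 < n) :
    [(∀ M : ModuleCat.{u} R, HasEpimorphicEnvelope (IsFPFlat (R := R) n) M),
      IsRightNHereditary R n,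
      IsClosedUnderSubmodules (IsFPFlat (R := R) n),
      IsPretorsionFreeClass (IsFPFlat (R := R) n)].TFAE := by
  obtain ⟨n, rfl⟩ := Nat.exists_eq_add_of_le' hn
  tfae_have 1 → 3 := isClosedUnderSubmodules_of_hasEpimorphicEnvelope
  tfae_have 2 → 3 := isClosedUnderSubmodules_of_isRightNHereditary
  tfae_have 3 → 2 := isRightNHereditary_of_isClosedUnderSubmodules
  tfae_have 3 → 4 := fun h => ⟨h, isClosedUnderDirectProducts_isFPFlat⟩
  tfae_have 4 → 1 := IsPretorsionFreeClass.hasEpimorphicEnvelope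
  tfae_finish
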